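/- Let $F \subseteq L$ be number fields such that $L/F$ is a cyclic (Galois) extension whose degree $q=[L:F]$ is an odd prime, and suppose that the class number $h(L)$ of $L$ satisfies $h(L)>1$. Let $m=[F:\mathbb{Q}]$, let $D_F$ be the discriminant of $F$, and put $$H_F=\frac{2^{m-1}}{(m-1)!}\,\sqrt{|D_F|}\,\bigl(\log|D_F|\bigr)^{m-1},$$ where $(\log|D_F|)^{m-1}=1$ if $m=1$. Let $p$ be a prime dividing $h(L)$ with $p>H_F$, and let $r_p$ be the rank of the $p$-class group of $L$, that is, the number of factors when the $p$-primary subgroup of the class group of $L$ is written as a direct sum of nontrivial cyclic groups of $p$-power order. Then $$p\,\bigl(p^{r_p}-1\bigr)\equiv 0 \pmod q .$$ -/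

import Mathlib

open scoped NumberField

/-- `IsPRank p G r`: the `p`-primary subgroup of the abelian group `G` (written additively) is a
direct sum of `r` nontrivial cyclic groups whose orders are powers of `p`. For finite `G` such an
`r` exists and is unique: it is the `p`-rank of `G`. -/
def IsPRank (p : ℕ) [Fact p.Prime] (G : Type*) [CommGroup G] (r : ℕ) : Prop :=
  ∃ e : Fin r → ℕ, (∀ i, 1 ≤ e i) ∧
    Nonempty (Additive (CommGroup.primaryComponent G p) ≃+ ((i : Fin r) → ZMod (p ^ e i)))

/-- Every finite abelian group has a `p`-rank. -/
theorem exists_isPRank (p : ℕ) [hp : Fact p.Prime] (G : Type*) [CommGroup G] [Finite G] :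
    ∃ r : ℕ, IsPRank p G r := by
  obtain ⟨ι, hι, n, hn, ⟨f⟩⟩ :=
    AddCommGroup.equiv_directSum_zmod_of_finite' (Additive (CommGroup.primaryComponent G p))
  classical
  have f' := f.trans (DirectSum.addEquivProd (fun i => ZMod (n i)))
  obtain ⟨k, hk⟩ := (IsPGroup.iff_card (p := p) (G := CommGroup.primaryComponent G p)).1
    (CommGroup.primaryComponent.isPGroup)
  have hc : ∏ i, n i = p ^ k := by
    have h := Nat.card_congr f'.toEquiv
    rw [Nat.card_pi] at h
    simp only [Nat.card_zmod] at h
    rw [← h, ← hk]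
    rfl
  have he : ∀ i, ∃ e, 1 ≤ e ∧ n i = p ^ e := by
    intro i
    have hd : n i ∣ p ^ k := hc ▸ Finset.dvd_prod_of_mem n (Finset.mem_univ i)
    obtain ⟨e, -, h⟩ := (Nat.dvd_prime_pow hp.out).1 hd
    refine ⟨e, ?_, h⟩
    have := hn i
    rcases Nat.eq_zero_or_pos e with h0 | h0
    · subst h0
      simp at h
      omega
    · exact h0
  choose e he1 he2 using he
  obtain rfl : n = fun i => p ^ e i := funext he2
  let s := Fintype.equivFin ι
  refine ⟨Fintype.card ι, fun j => e (s.symm j), fun j => he1 _, ⟨f'.trans ?_⟩⟩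
  exact { Equiv.piCongrLeft' (fun i => ZMod (p ^ e i)) s with map_add' := fun x y => rfl }

/-- The explicit upper bound `2 ^ (m - 1) / (m - 1)! * √|D_F| * (log |D_F|) ^ (m - 1)` for the
class number of `F`, where `m = [F : ℚ]` is positive and `D_F` is the discriminant of `F`. -/
noncomputable def classNumberBound (F : Type*) [Field F] [NumberField F] : ℝ :=
  (2 : ℝ) ^ (Module.finrank ℚ F - 1) / (Nat.factorial (Module.finrank ℚ F - 1) : ℝ) *
    Real.sqrt |(NumberField.discr F : ℝ)| *
    Real.log |(NumberField.discr F : ℝ)| ^ (Module.finrank ℚ F - 1)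

/-!
The Galois group `G = Gal(L/F)` has prime order `q` and acts on the `p`-torsion of the class group
of `L`, which has `p ^ r` elements (`IsPRank.card_pow_eq_one`). So `p ^ r` is congruent modulo `q` to
the number of fixed points, and unless `p = q`, where the claim is trivial, it is enough to see that
the trivial class is the only fixed point.

For an ideal `I` of `L` the product of its conjugates is extended from `F`
(`exists_map_eq_prod_smul`). Hence for a fixed class `c`, the power `c ^ q = ∏ g, g • c` comes from
the class group of `F`, and `c ^ (q * h(F)) = 1`. If also `c ^ p = 1` with `p ≠ q` and `p ∤ h(F)`,
then `c = 1` (`card_pow_eq_one_modEq_one`).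

That `p ∤ h(F)` follows from `p > H_F ≥ h(F)` (`classNumber_le_classNumberBound`). For this bound
let `n = [F : ℚ]`. At most `n` primes of `F` lie above each rational prime, so the primes of `F` can be
coloured with `n` colours, distinct ones above the same rational prime having distinct colours. An
ideal is then determined by the `n`-tuple of the norms of its parts of each colour, and the product
of these is its norm (`prod_colorNorm`, `eq_of_colorNorm_eq`). The number of `n`-tuples of positive
integers with product at most `x` is at most `x (n - 1 + log x) ^ (n - 1) / (n - 1)!`
(`card_le_of_prod_le`). Each class contains an ideal of norm at most the Minkowski bound
`x ≤ √|D|`, and `n - 1 ≤ (3 / 2) log |D|` by Minkowski's lower bound for the discriminant, so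
`n - 1 + log x ≤ 2 log |D|`.
-/

open scoped nonZeroDivisors

/-! ### Counting tuples of positive integers with bounded product -/

/-- One step of comparing `∑ b⁻¹ * (k + log (x / b)) ^ k` with an integral, made discrete: the
term at `b` is at most the increment of the antiderivative `-(k + log (x / b)) ^ (k + 1) / (k + 1)`
between `b - 1` and `b`, so that the sum over `b ≥ 2` telescopes. -/
theorem inv_mul_pow_le_sub_pow (k : ℕ) {x b : ℝ} (hb : 2 ≤ b) (hbx : b ≤ x) :
    b⁻¹ * (k + Real.log (x / b)) ^ k ≤
      ((k + Real.log (x / (b - 1))) ^ (k + 1) - (k + Real.log (x / b)) ^ (k + 1)) / (k + 1) := by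
  have hx : 0 < x := by linarith
  set u := k + Real.log (x / b) with hu
  have hu0 : 0 ≤ u := add_nonneg k.cast_nonneg (Real.log_nonneg (by rwa [one_le_div (by linarith)]))
  -- `1 / b ≤ log b - log (b - 1)`
  have hlog : b⁻¹ ≤ Real.log (x / (b - 1)) - Real.log (x / b) := by
    rw [Real.log_div hx.ne' (by linarith), Real.log_div hx.ne' (by linarith)]
    have h := Real.log_le_sub_one_of_pos (x := (b - 1) / b) (div_pos (by linarith) (by linarith))
    rw [Real.log_div (by linarith) (by linarith), sub_div, div_self (by linarith), one_div] at h
    linarith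
  have hv : u + b⁻¹ ≤ k + Real.log (x / (b - 1)) := by rw [hu]; linarith
  have hpow : u ^ (k + 1) + (k + 1) * u ^ k * b⁻¹ ≤ (u + b⁻¹) ^ (k + 1) := by
    have hb0 : 0 ≤ b⁻¹ := by positivity
    simpa using pow_add_mul_le_add_pow hu0 (by linarith : 0 ≤ 2 * u + b⁻¹) (k + 1)
  have := pow_le_pow_left₀ (by positivity) hv (k + 1)
  rw [le_div_iff₀ (by positivity)]
  nlinarith

theorem sum_inv_mul_pow_le (k N : ℕ) {x : ℝ} (hN : 1 ≤ N) (hNx : N ≤ x) :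
    ∑ b ∈ Finset.Icc 1 N, (b : ℝ)⁻¹ * (k + Real.log (x / b)) ^ k ≤
      (k + Real.log x) ^ k +
        ((k + Real.log x) ^ (k + 1) - (k + Real.log (x / N)) ^ (k + 1)) / (k + 1) := by
  induction N, hN using Nat.le_induction with
  | base => simp
  | succ N hN ih =>
    rw [Finset.sum_Icc_succ_top (by omega)]
    push_cast at hNx ⊢
    have hN' : (1 : ℝ) ≤ N := by exact_mod_cast hN
    have h1 := ih (by linarith)
    have h2 := inv_mul_pow_le_sub_pow k (b := N + 1) (by linarith) hNx
    rw [add_sub_cancel_right] at h2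
    calc _ ≤ _ := add_le_add h1 h2
      _ = _ := by ring

/-- The induction step for counting tuples: fixing the first entry `b` of a `(k + 2)`-tuple leaves a
`(k + 1)`-tuple with product at most `x / b`. The constant `k` in `(k + log x) ^ k` is what absorbs
the term `b = 1`, which the telescoping leaves out. -/
theorem sum_div_mul_pow_le (k : ℕ) {x : ℝ} (hx : 1 ≤ x) :
    ∑ b ∈ Finset.Icc 1 ⌊x⌋₊, x / b * (k + Real.log (x / b)) ^ k / k.factorial ≤
      x * ((k + 1 : ℕ) + Real.log x) ^ (k + 1) / (k + 1).factorial := by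
  have hN : 1 ≤ ⌊x⌋₊ := (Nat.one_le_floor_iff x).2 hx
  have hNx : (⌊x⌋₊ : ℝ) ≤ x := Nat.floor_le (by linarith)
  have hN' : (1 : ℝ) ≤ ⌊x⌋₊ := by exact_mod_cast hN
  have h := sum_inv_mul_pow_le k ⌊x⌋₊ hN hNx
  have hl : 0 ≤ Real.log x := Real.log_nonneg hx
  have hu : (0 : ℝ) ≤ k + Real.log x := by positivity
  have hpos : 0 ≤ (k + Real.log (x / ⌊x⌋₊)) ^ (k + 1) :=
    pow_nonneg (add_nonneg k.cast_nonneg (Real.log_nonneg (by rwa [one_le_div (by linarith)]))) _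
  have hpow : (k + Real.log x) ^ (k + 1) + (k + 1) * (k + Real.log x) ^ k ≤
      (k + Real.log x + 1) ^ (k + 1) := by
    simpa using pow_add_mul_le_add_pow hu (by linarith : 0 ≤ 2 * (k + Real.log x) + 1) (k + 1)
  calc _ = x / k.factorial *
        ∑ b ∈ Finset.Icc 1 ⌊x⌋₊, (b : ℝ)⁻¹ * (k + Real.log (x / b)) ^ k := by
        rw [Finset.mul_sum]
        refine Finset.sum_congr rfl fun b _ ↦ ?_
        ring
    _ ≤ x / k.factorial * ((k + Real.log x + 1) ^ (k + 1) / (k + 1)) := by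
        gcongr
        refine h.trans ?_
        rw [le_div_iff₀ (by positivity), add_mul, div_mul_cancel₀ _ (by positivity)]
        linarith
    _ = _ := by
        rw [Nat.factorial_succ]
        push_cast
        field_simp
        ring

/-- There are at most `x * (k + log x) ^ k / k!` tuples of `k + 1` positive integers with product at
most `x`. By induction on `k`, fixing the first entry `b` and counting the tails, whose product is
at most `x / b`. -/
theorem card_le_of_prod_le (k : ℕ) {x : ℝ} (hx : 1 ≤ x) (S : Finset (Fin (k + 1) → ℕ))
    (hS : ∀ a ∈ S, (∀ i, 1 ≤ a i) ∧ ((∏ i, a i : ℕ) : ℝ) ≤ x) :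
    (S.card : ℝ) ≤ x * (k + Real.log x) ^ k / k.factorial := by
  induction k generalizing x with
  | zero =>
    have h : S.card ≤ (Finset.Icc 1 ⌊x⌋₊).card := by
      refine Finset.card_le_card_of_injOn (fun a ↦ a 0) (fun a ha ↦ ?_) fun a _ b _ hab ↦ ?_
      · simpa [Nat.le_floor_iff (by linarith : 0 ≤ x)] using And.intro ((hS a ha).1 0) (hS a ha).2
      · ext i
        rw [Fin.fin_one_eq_zero i]
        exact hab
    rw [Nat.card_Icc, Nat.add_sub_cancel] at h
    calc (S.card : ℝ) ≤ ⌊x⌋₊ := by exact_mod_cast h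
      _ ≤ x := Nat.floor_le (by linarith)
      _ = _ := by simp
  | succ k ih =>
    have hmaps : ∀ a ∈ S, a 0 ∈ Finset.Icc 1 ⌊x⌋₊ := by
      intro a ha
      obtain ⟨h1, h2⟩ := hS a ha
      rw [Finset.mem_Icc, Nat.le_floor_iff (by linarith)]
      refine ⟨h1 0, le_trans ?_ h2⟩
      exact_mod_cast Finset.single_le_prod' (f := a) (fun i _ ↦ h1 i) (Finset.mem_univ 0)
    rw [Finset.card_eq_sum_card_fiberwise hmaps, Nat.cast_sum]
    refine (Finset.sum_le_sum fun b hb ↦ ?_).trans (sum_div_mul_pow_le k hx)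
    rw [Finset.mem_Icc, Nat.le_floor_iff (by linarith)] at hb
    have hb0 : (0 : ℝ) < b := by exact_mod_cast hb.1
    have hinj : Set.InjOn (Fin.tail : (Fin (k + 2) → ℕ) → _) (S.filter fun a ↦ a 0 = b) := by
      intro a ha c hc hac
      rw [Finset.mem_coe, Finset.mem_filter] at ha hc
      rw [← Fin.cons_self_tail a, ← Fin.cons_self_tail c, hac, ha.2, hc.2]
    rw [← Finset.card_image_of_injOn hinj]
    refine ih (x := x / b) (by rw [one_le_div hb0]; exact hb.2) _ fun a' ha' ↦ ?_
    obtain ⟨a, ha, rfl⟩ := Finset.mem_image.1 ha'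
    obtain ⟨haS, rfl⟩ := Finset.mem_filter.1 ha
    obtain ⟨h1, h2⟩ := hS a haS
    refine ⟨fun i ↦ h1 _, ?_⟩
    rw [le_div_iff₀ hb0]
    refine le_trans (le_of_eq ?_) h2
    rw [Fin.prod_univ_succ a, mul_comm, Nat.cast_mul]
    rfl

/-! ### Ideals as tuples of positive integers -/

section Coloring

variable {R ι : Type*} [CommRing R] [IsDedekindDomain R] [Module.Free ℤ R] [DecidableEq ι]

/-- For a multiset `s` of ideals coloured by `c`, the product of the norms of those of colour
`i`. -/
noncomputable def colorNorm (c : Ideal R → ι) (s : Multiset (Ideal R)) (i : ι) : ℕ :=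
  ((s.filter fun P ↦ c P = i).map Ideal.absNorm).prod

theorem colorNorm_cons (c : Ideal R → ι) (P : Ideal R) (s : Multiset (Ideal R)) (i : ι) :
    colorNorm c (P ::ₘ s) i = (if c P = i then Ideal.absNorm P else 1) * colorNorm c s i := by
  unfold colorNorm
  split_ifs with h <;> simp [h]

theorem prod_colorNorm [Module.Finite ℤ R] [Fintype ι] (c : Ideal R → ι) (s : Multiset (Ideal R)) :
    ∏ i, colorNorm c s i = Ideal.absNorm s.prod := by
  induction s using Multiset.induction with
  | empty => simp [colorNorm]
  | cons P s ih =>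
    simp only [colorNorm_cons, Finset.prod_mul_distrib, ih]
    simp

/-- The norm of a prime `Q` is a power of the rational prime below it, so it determines that
prime. -/
theorem under_int_eq_of_dvd_absNorm [Module.Finite ℤ R] {P Q : Ideal R} [P.IsPrime] [Q.IsPrime]
    (hP : P ≠ ⊥) (hQ : Q ≠ ⊥) (h : Ideal.absNorm (P.under ℤ) ∣ Ideal.absNorm Q) :
    P.under ℤ = Q.under ℤ := by
  have : NeZero P := ⟨hP⟩
  have : NeZero Q := ⟨hQ⟩
  have hp := Nat.absNorm_under_prime P
  have hq := Nat.absNorm_under_prime Q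
  rw [Ideal.absNorm_eq_pow_inertiaDeg' Q hq] at h
  rw [← Int.ideal_span_absNorm_eq_self (P.under ℤ), ← Int.ideal_span_absNorm_eq_self (Q.under ℤ),
    (Nat.prime_dvd_prime_iff_eq hp hq).1 (hp.dvd_of_dvd_pow h)]

/-- If primes of the same colour above the same rational prime are equal, a multiset of primes is
determined by its coloured norms: for `P` in the first multiset, the norm of colour `c P` of the
second one is divisible by the rational prime below `P`, which forces `P` to occur there, and `P`
can be cancelled. -/
theorem eq_of_colorNorm_eq [Module.Finite ℤ R] {c : Ideal R → ι}
    (hc : ∀ P Q : Ideal R, P.IsPrime → Q.IsPrime → P ≠ ⊥ → P.under ℤ = Q.under ℤ →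
      c P = c Q → P = Q) {s t : Multiset (Ideal R)} (hs : ∀ P ∈ s, Prime P) (ht : ∀ P ∈ t, Prime P)
    (h : colorNorm c s = colorNorm c t) : s = t := by
  induction s using Multiset.induction generalizing t with
  | empty =>
    refine (Multiset.eq_zero_of_forall_notMem fun Q hQ ↦ (ht Q hQ).not_isUnit ?_).symm
    have h1 : Ideal.absNorm Q ∣ colorNorm c t (c Q) :=
      Multiset.dvd_prod (Multiset.mem_map_of_mem _ (Multiset.mem_filter.2 ⟨hQ, rfl⟩))
    rw [← h] at h1
    rw [Ideal.isUnit_iff, ← Ideal.absNorm_eq_one_iff]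
    simpa [colorNorm] using h1
  | cons P s ih =>
    have hP := hs P (Multiset.mem_cons_self P s)
    have := Ideal.isPrime_of_prime hP
    have : NeZero P := ⟨hP.ne_zero⟩
    have h1 : Ideal.absNorm (P.under ℤ) ∣ colorNorm c t (c P) := by
      rw [← h, colorNorm_cons, if_pos rfl]
      exact (Int.absNorm_under_dvd_absNorm P).mul_right _
    obtain ⟨_, hN, hdvd⟩ := (Nat.absNorm_under_prime P).prime.exists_mem_multiset_dvd h1
    obtain ⟨Q, hQ, rfl⟩ := Multiset.mem_map.1 hN
    obtain ⟨hQ, hcQ⟩ := Multiset.mem_filter.1 hQ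
    have := Ideal.isPrime_of_prime (ht Q hQ)
    obtain rfl : P = Q := hc P Q inferInstance inferInstance hP.ne_zero
      (under_int_eq_of_dvd_absNorm hP.ne_zero (ht Q hQ).ne_zero hdvd) hcQ.symm
    obtain ⟨t, rfl⟩ := Multiset.exists_cons_of_mem hQ
    rw [ih (fun Q hQ ↦ hs Q (Multiset.mem_cons_of_mem hQ))
      (fun Q hQ ↦ ht Q (Multiset.mem_cons_of_mem hQ))]
    funext i
    have hi := congrFun h i
    rw [colorNorm_cons, colorNorm_cons] at hi
    refine Nat.eq_of_mul_eq_mul_left (Nat.pos_of_ne_zero ?_) hi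
    split_ifs
    · exact Ideal.absNorm_eq_zero_iff.not.2 hP.ne_zero
    · exact one_ne_zero

end Coloring

section ClassNumber

variable (K : Type*) [Field K] [NumberField K]

theorem card_primesOver_le_finrank (p : Ideal ℤ) [p.IsPrime] :
    Nat.card (p.primesOver (𝓞 K)) ≤ Module.finrank ℚ K := by
  have := (Algebra.QuasiFinite.finite_primesOver (S := 𝓞 K) p).to_subtype
  have : Fintype (p.primesOver (𝓞 K)) := Fintype.ofFinite _
  rw [← NumberField.RingOfIntegers.rank K, ← Ideal.sum_ramification_inertia_eq_finrank p (𝓞 K),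
    Nat.card_eq_fintype_card, ← Finset.card_univ, Finset.card_eq_sum_ones]
  refine Finset.sum_le_sum fun P _ ↦ ?_
  exact Nat.mul_pos (P.1.ramificationIdx_pos ℤ) (P.1.inertiaDeg_pos ℤ)

/-- The primes of `K` can be coloured with `[K : ℚ]` colours so that distinct primes above the same
rational prime have distinct colours. -/
theorem exists_coloring {n : ℕ} (hn : Module.finrank ℚ K = n) :
    ∃ c : Ideal (𝓞 K) → Fin n, ∀ P Q : Ideal (𝓞 K), P.IsPrime → Q.IsPrime → P ≠ ⊥ →
      P.under ℤ = Q.under ℤ → c P = c Q → P = Q := by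
  classical
  have hpos : 0 < n := hn ▸ Module.finrank_pos
  have : ∀ p : Ideal ℤ, ∃ f : Ideal (𝓞 K) → Fin n, p.IsPrime → p ≠ ⊥ →
      Set.InjOn f (p.primesOver (𝓞 K)) := by
    intro p
    by_cases hp : p.IsPrime ∧ p ≠ ⊥
    · have := hp.1
      have := (Algebra.QuasiFinite.finite_primesOver (S := 𝓞 K) p).to_subtype
      have hle := card_primesOver_le_finrank K p
      let e := Finite.equivFin (p.primesOver (𝓞 K))
      refine ⟨fun P ↦ if h : P ∈ p.primesOver (𝓞 K) then Fin.castLE (hn ▸ hle) (e ⟨P, h⟩)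
        else ⟨0, hpos⟩, fun _ _ P hP Q hQ h ↦ ?_⟩
      simp only [hP, hQ, dif_pos] at h
      exact congrArg Subtype.val (e.injective (Fin.castLE_injective _ h))
    · exact ⟨fun _ ↦ ⟨0, hpos⟩, fun h1 h2 ↦ absurd ⟨h1, h2⟩ hp⟩
  choose f hf using this
  refine ⟨fun P ↦ f (P.under ℤ) P, fun P Q hP hQ hP0 hPQ h ↦ ?_⟩
  refine hf (P.under ℤ) inferInstance (Ideal.IsIntegral.comap_ne_bot ℤ hP0) ⟨hP, ⟨rfl⟩⟩
    ⟨hQ, ⟨hPQ⟩⟩ ?_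
  exact h.trans (by rw [hPQ])

/-- Choosing an ideal of norm at most `x` in each class and sending it to its coloured norms embeds
the class group into the tuples of `[K : ℚ]` positive integers with product at most `x`. -/
theorem classNumber_le_of_norm_le (k : ℕ) (hk : Module.finrank ℚ K = k + 1) {x : ℝ} (hx : 1 ≤ x)
    (h : ∀ C : ClassGroup (𝓞 K), ∃ I : (Ideal (𝓞 K))⁰, ClassGroup.mk0 I = C ∧
      (Ideal.absNorm (I : Ideal (𝓞 K)) : ℝ) ≤ x) :
    (NumberField.classNumber K : ℝ) ≤ x * (k + Real.log x) ^ k / k.factorial := by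
  classical
  obtain ⟨c, hc⟩ := exists_coloring K hk
  choose I hI hIx using h
  have hI0 : ∀ C, (I C : Ideal (𝓞 K)) ≠ 0 := fun C ↦ nonZeroDivisors.ne_zero (I C).2
  let φ : ClassGroup (𝓞 K) → Fin (k + 1) → ℕ := fun C ↦
    colorNorm c (UniqueFactorizationMonoid.normalizedFactors (I C : Ideal (𝓞 K)))
  have hφ : Function.Injective φ := fun C D h ↦ by
    have h1 := eq_of_colorNorm_eq hc
      (fun P hP ↦ UniqueFactorizationMonoid.prime_of_normalized_factor P hP)
      (fun P hP ↦ UniqueFactorizationMonoid.prime_of_normalized_factor P hP) h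
    rw [← hI C, ← hI D]
    congr 1
    refine Subtype.ext ?_
    rw [← associated_iff_eq,
      UniqueFactorizationMonoid.associated_iff_normalizedFactors_eq_normalizedFactors
        (hI0 C) (hI0 D), h1]
  have hprod : ∀ C, ∏ i, φ C i = Ideal.absNorm (I C : Ideal (𝓞 K)) := fun C ↦ by
    rw [prod_colorNorm, Ideal.prod_normalizedFactors_eq_self (hI0 C)]
  have hcard : (Finset.univ.image φ).card = NumberField.classNumber K := by
    rw [Finset.card_image_of_injective _ hφ, NumberField.classNumber, Finset.card_univ]
  rw [← hcard]
  refine card_le_of_prod_le k hx _ fun a ha ↦ ?_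
  obtain ⟨C, -, rfl⟩ := Finset.mem_image.1 ha
  refine ⟨fun i ↦ Nat.one_le_iff_ne_zero.2 fun h0 ↦ ?_, ?_⟩
  · refine Ideal.absNorm_eq_zero_iff.not.2 (hI0 C) ?_
    rw [← hprod C]
    exact Finset.prod_eq_zero (Finset.mem_univ i) h0
  · rw [hprod]
    exact hIx C

end ClassNumber

/-! ### The class number bound -/

theorem two_pow_mul_factorial_le (n : ℕ) : 2 ^ n * (n + 1).factorial ≤ (n + 1) ^ (n + 1) := by
  induction n with
  | zero => simp
  | succ n ih =>
    have h : 2 * (n + 1) ^ (n + 1) ≤ (n + 2) ^ (n + 1) := by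
      have := pow_add_mul_le_add_pow (a := n + 1) (b := 1) (by positivity) (by positivity) (n + 1)
      simp only [Nat.add_sub_cancel, mul_one, Nat.cast_id] at this
      calc 2 * (n + 1) ^ (n + 1) = (n + 1) ^ (n + 1) + (n + 1) * (n + 1) ^ n := by ring
        _ ≤ (n + 2) ^ (n + 1) := this
    calc 2 ^ (n + 1) * (n + 2).factorial = (n + 2) * (2 * (2 ^ n * (n + 1).factorial)) := by
          rw [Nat.factorial_succ]; ring
      _ ≤ (n + 2) * (n + 2) ^ (n + 1) := by gcongr; exact (Nat.mul_le_mul_left 2 ih).trans h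
      _ = (n + 2) ^ (n + 2) := by ring

section Bound

variable (K : Type*) [Field K] [NumberField K]

open NumberField NumberField.InfinitePlace Module

theorem minkowski_constant_le_one :
    (4 / Real.pi) ^ nrComplexPlaces K *
      ((finrank ℚ K).factorial / (finrank ℚ K : ℝ) ^ finrank ℚ K) ≤ 1 := by
  obtain ⟨k, hk⟩ := Nat.exists_eq_succ_of_ne_zero (finrank_pos (R := ℚ) (M := K)).ne'
  have hr : nrComplexPlaces K ≤ k := by
    have := card_add_two_mul_card_eq_rank K
    omega
  -- `4 / π ≤ 2`, and `r₂ ≤ [K : ℚ] - 1` because `2 * r₂ ≤ [K : ℚ]`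
  have h2 : (4 / Real.pi) ^ nrComplexPlaces K ≤ 2 ^ k := by
    refine (pow_le_pow_left₀ (by positivity) ?_ _).trans (pow_le_pow_right₀ one_le_two hr)
    rw [div_le_iff₀ Real.pi_pos]
    linarith [Real.pi_gt_three]
  rw [hk, ← mul_div_assoc, div_le_one (by positivity)]
  refine (mul_le_mul_of_nonneg_right h2 (by positivity)).trans ?_
  exact_mod_cast two_pow_mul_factorial_le k

/-- Minkowski's lower bound for the discriminant in the form `[K : ℚ] - 1 ≤ (3 / 2) log |D|`, which
absorbs the summand `k` of `k + log x` into a multiple of `log |D|`. -/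
theorem two_mul_le_three_mul_log_discr {k : ℕ} (hk : finrank ℚ K = k + 1) :
    2 * (k : ℝ) ≤ 3 * Real.log |(discr K : ℝ)| := by
  rcases Nat.eq_zero_or_pos k with rfl | hk0
  · have : (1 : ℝ) ≤ |(discr K : ℝ)| := by
      exact_mod_cast Int.one_le_abs (discr_ne_zero K)
    simpa using Real.log_nonneg this
  have h := abs_discr_ge (K := K) (by omega)
  rw [hk, Int.cast_abs] at h
  have hpi := Real.pi_gt_three
  have h1 : ((9 : ℝ) / 4) ^ k ≤ |(discr K : ℝ)| := by
    refine le_trans ?_ h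
    calc ((9 : ℝ) / 4) ^ k ≤ (3 * Real.pi / 4) ^ k := by
          gcongr
          linarith
      _ ≤ (4 / 9 * (3 * Real.pi / 4)) * (3 * Real.pi / 4) ^ k := by
          refine le_mul_of_one_le_left (by positivity) ?_
          linarith
      _ = _ := by ring
  have h2 : (k : ℝ) * Real.log (9 / 4) ≤ Real.log |(discr K : ℝ)| := by
    rw [← Real.log_pow]
    exact Real.log_le_log (by positivity) h1
  -- `log (9 / 4) ≥ 2 / 3`, since `e ^ 2 < 2.7183 ^ 2 < (9 / 4) ^ 3`
  have h3 : (2 : ℝ) ≤ 3 * Real.log (9 / 4) := by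
    have he : Real.exp 2 ≤ ((9 : ℝ) / 4) ^ 3 := by
      rw [show (2 : ℝ) = 1 + 1 by norm_num, Real.exp_add]
      have := Real.exp_one_lt_d9
      have h0 := Real.exp_pos 1
      nlinarith
    have := (Real.le_log_iff_exp_le (by positivity)).2 he
    rw [Real.log_pow] at this
    exact_mod_cast this
  nlinarith [(Nat.cast_nonneg k : (0 : ℝ) ≤ k)]

theorem classNumber_le_classNumberBound : (classNumber K : ℝ) ≤ classNumberBound K := by
  obtain ⟨k, hk⟩ := Nat.exists_eq_succ_of_ne_zero (finrank_pos (R := ℚ) (M := K)).ne'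
  have hc := minkowski_constant_le_one K
  have hn := exists_ideal_in_class_of_norm_le (K := K)
  have hlogD := two_mul_le_three_mul_log_discr K hk
  set D : ℝ := |(discr K : ℝ)| with hD
  have hD1 : 1 ≤ D := by
    rw [hD]
    exact_mod_cast Int.one_le_abs (discr_ne_zero K)
  set c : ℝ := (4 / Real.pi) ^ nrComplexPlaces K *
      ((finrank ℚ K).factorial / (finrank ℚ K : ℝ) ^ finrank ℚ K) with hcdef
  have hM : ∀ C : ClassGroup (𝓞 K), ∃ I : (Ideal (𝓞 K))⁰, ClassGroup.mk0 I = C ∧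
      (Ideal.absNorm (I : Ideal (𝓞 K)) : ℝ) ≤ c * √D := fun C ↦ by
    obtain ⟨I, hI, h⟩ := hn C
    refine ⟨I, hI, h.trans (le_of_eq ?_)⟩
    rw [hcdef]
    ring
  have hx1 : 1 ≤ c * √D := by
    obtain ⟨I, -, hI⟩ := hM 1
    refine le_trans ?_ hI
    exact_mod_cast Nat.one_le_iff_ne_zero.2 (Ideal.absNorm_ne_zero_of_nonZeroDivisors I)
  have hxD : c * √D ≤ √D := mul_le_of_le_one_left (Real.sqrt_nonneg _) hc
  have hlog : Real.log (c * √D) ≤ Real.log D / 2 := by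
    rw [← Real.log_sqrt (by linarith)]
    exact Real.log_le_log (by linarith) hxD
  have hlog0 := Real.log_nonneg hx1
  calc (classNumber K : ℝ) ≤ c * √D * (k + Real.log (c * √D)) ^ k / k.factorial :=
        classNumber_le_of_norm_le K k hk hx1 hM
    _ ≤ √D * (2 * Real.log D) ^ k / k.factorial := by
        gcongr
        -- `k ≤ (3 / 2) log D` and `log (c * √D) ≤ (1 / 2) log D` add up to `2 log D`
        linarith
    _ = classNumberBound K := by
        rw [classNumberBound, hk, Nat.succ_sub_one, ← hD]
        ring

end Bound

/-! ### Products of conjugate ideals -/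

open scoped Pointwise

/-- The elements carrying `x` to a given point of its orbit form a coset of the stabilizer. -/
theorem card_filter_smul_eq {G X : Type*} [Group G] [Fintype G] [MulAction G X] [DecidableEq X]
    {x y : X} (h : ∃ g : G, g • x = y) :
    (Finset.univ.filter fun g : G ↦ g • x = y).card = Nat.card (MulAction.stabilizer G x) := by
  obtain ⟨t, rfl⟩ := h
  rw [← Nat.card_eq_finsetCard]
  refine Nat.card_congr ((Equiv.mulLeft t⁻¹).subtypeEquiv fun g ↦ ?_)
  simp [mul_smul, inv_smul_eq_iff]

section Galois

variable (F L : Type*) [Field L] [NumberField L] [Field F] [NumberField F] [Algebra F L]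
  [IsGalois F L]

/-- The product of the conjugates of a prime `P` above `p` is extended from `p ^ f`, with `f` the
inertia degree: each prime above `p` occurs as often as the stabilizer of `P` has elements, which is
`e * f`. -/
theorem exists_map_eq_prod_smul_of_isPrime (P : Ideal (𝓞 L)) [P.IsPrime] (hP : P ≠ ⊥) :
    ∃ A : Ideal (𝓞 F), A.map (algebraMap (𝓞 F) (𝓞 L)) = ∏ g : L ≃ₐ[F] L, g • P := by
  classical
  let G := L ≃ₐ[F] L
  let p := P.under (𝓞 F)
  have hp0 : p ≠ ⊥ := Ideal.IsIntegral.comap_ne_bot (𝓞 F) hP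
  have : p.IsMaximal := Ideal.IsPrime.isMaximal inferInstance hp0
  refine ⟨p ^ p.inertiaDegIn (𝓞 L), ?_⟩
  have hmap : ∀ g ∈ (Finset.univ : Finset G), g • P ∈ (p.primesOver (𝓞 L)).toFinset := by
    intro g _
    rw [Set.mem_toFinset]
    exact ⟨inferInstance, inferInstance⟩
  have hstab : Nat.card (MulAction.stabilizer G P) =
      p.ramificationIdxIn (𝓞 L) * p.inertiaDegIn (𝓞 L) := by
    have h1 := Ideal.ncard_primesOver_mul_ramificationIdxIn_mul_inertiaDegIn p (𝓞 L) G
    have h2 := (MulAction.stabilizer G P).card_mul_index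
    rw [MulAction.index_stabilizer, Algebra.IsInvariant.orbit_eq_primesOver (𝓞 F) (𝓞 L) G p P,
      mul_comm, ← h1] at h2
    exact Nat.eq_of_mul_eq_mul_left
      (Nat.pos_of_ne_zero (IsDedekindDomain.primesOver_ncard_ne_zero p (𝓞 L))) h2
  rw [Ideal.map_pow, Ideal.map_algebraMap_eq_finsetProd_pow hp0, ← Finset.prod_pow,
    ← Finset.prod_fiberwise_of_maps_to hmap]
  refine Finset.prod_congr rfl fun Q hQ ↦ ?_
  rw [Set.mem_toFinset] at hQ
  have : Q.IsPrime := hQ.1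
  have : Q.LiesOver p := hQ.2
  rw [Finset.prod_congr rfl (g := fun _ ↦ Q) (by simp), Finset.prod_const,
    card_filter_smul_eq (Ideal.exists_smul_eq_of_isGaloisGroup p P Q G), hstab, ← pow_mul,
    Ideal.ramificationIdxIn_eq_ramificationIdx p Q G]

/-- The product of the conjugates of an ideal is the extension of an ideal of the base field, its
relative norm. -/
theorem exists_map_eq_prod_smul (I : Ideal (𝓞 L)) :
    ∃ A : Ideal (𝓞 F), A.map (algebraMap (𝓞 F) (𝓞 L)) = ∏ g : L ≃ₐ[F] L, g • I := by
  induction I using UniqueFactorizationMonoid.induction_on_prime with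
  | h₁ =>
    refine ⟨⊥, ?_⟩
    simp [Finset.prod_const]
  | h₂ I hI =>
    rw [Ideal.isUnit_iff] at hI
    refine ⟨⊤, ?_⟩
    rw [Ideal.map_top, hI]
    simp only [← Ideal.one_eq_top, smul_one, Finset.prod_const_one]
  | h₃ I P hI hP ih =>
    obtain ⟨A, hA⟩ := ih
    have := Ideal.isPrime_of_prime hP
    obtain ⟨B, hB⟩ := exists_map_eq_prod_smul_of_isPrime F L P hP.ne_zero
    exact ⟨B * A, by simp [Ideal.map_mul, hA, hB, smul_mul', Finset.prod_mul_distrib]⟩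

end Galois

/-! ### The `p`-torsion of a group of given `p`-rank -/

theorem card_nsmul_eq_zero_zmod_prime_pow (p : ℕ) [hp : Fact p.Prime] {e : ℕ} (he : 1 ≤ e) :
    Nat.card {x : ZMod (p ^ e) // p • x = 0} = p := by
  classical
  have : NeZero (p ^ e) := ⟨pow_ne_zero _ hp.out.ne_zero⟩
  apply le_antisymm
  · rw [Nat.card_eq_fintype_card, Fintype.card_subtype]
    exact IsAddCyclic.card_nsmul_eq_zero_le hp.out.pos
  -- a subgroup of order `p`, by Cauchy's theorem, consists of such elements
  · obtain ⟨x, hx⟩ := exists_prime_addOrderOf_dvd_card (G := ZMod (p ^ e)) p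
      (by rw [ZMod.card]; exact dvd_pow_self p (by omega))
    refine (hx.symm.trans (Nat.card_zmultiples x).symm).trans_le ?_
    refine Nat.card_le_card_of_injective
      (fun y : AddSubgroup.zmultiples x ↦ (⟨y.1, ?_⟩ : {z : ZMod (p ^ e) // p • z = 0})) ?_
    · obtain ⟨_, k, rfl⟩ := y
      rw [smul_comm, addOrderOf_dvd_iff_nsmul_eq_zero.1 hx.dvd, smul_zero]
    · intro y z h
      exact Subtype.ext (congrArg (fun w ↦ w.1) h)

/-- The `p`-rank counts the `p`-torsion: each cyclic factor contributes exactly `p` elements killed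
by `p`. -/
theorem IsPRank.card_pow_eq_one {p : ℕ} [hp : Fact p.Prime] {G : Type*} [CommGroup G] {r : ℕ}
    (h : IsPRank p G r) : Nat.card {c : G // c ^ p = 1} = p ^ r := by
  obtain ⟨e, he, ⟨f⟩⟩ := h
  have h1 : Nat.card {c : G // c ^ p = 1} =
      Nat.card {x : (i : Fin r) → ZMod (p ^ e i) // p • x = 0} := by
    have hmem : ∀ c : G, c ^ p = 1 → c ∈ CommGroup.primaryComponent G p := fun c hc ↦ by
      obtain ⟨k, -, hk⟩ := (Nat.dvd_prime_pow hp.out).1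
        ((orderOf_dvd_of_pow_eq_one hc).trans (pow_one p).symm.dvd)
      exact ⟨k, hk ▸ pow_orderOf_eq_one c⟩
    have e1 : {c : G // c ^ p = 1} ≃
        {c : Additive (CommGroup.primaryComponent G p) // p • c = 0} :=
      { toFun := fun c ↦ ⟨Additive.ofMul ⟨c.1, hmem c.1 c.2⟩, by
          rw [← ofMul_pow]
          exact congrArg Additive.ofMul (Subtype.ext c.2)⟩
        invFun := fun c ↦ ⟨c.1.toMul.1, by
          have := congrArg (fun y ↦ (Additive.toMul y).1) c.2
          exact this⟩
        left_inv := fun c ↦ rfl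
        right_inv := fun c ↦ rfl }
    refine Nat.card_congr (e1.trans (f.toEquiv.subtypeEquiv fun c ↦ ?_))
    rw [← f.map_eq_zero_iff, map_nsmul]
    rfl
  have h2 : Nat.card {x : (i : Fin r) → ZMod (p ^ e i) // p • x = 0} =
      Nat.card ((i : Fin r) → {x : ZMod (p ^ e i) // p • x = 0}) :=
    Nat.card_congr ((Equiv.subtypeEquivRight fun x ↦ funext_iff).trans
      (Equiv.subtypePiEquivPi (p := fun i (x : ZMod (p ^ e i)) ↦ p • x = 0)))
  rw [h1, h2, Nat.card_pi, Finset.prod_congr rfl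
    fun i _ ↦ card_nsmul_eq_zero_zmod_prime_pow p (he i)]
  simp

/-! ### The Galois action on the class group -/

section Action

variable {G R : Type*} [Group G] [CommRing R] [IsDedekindDomain R] [MulSemiringAction G R]

theorem smul_mem_nonZeroDivisors_ideal (g : G) {I : Ideal R} (hI : I ∈ (Ideal R)⁰) :
    g • I ∈ (Ideal R)⁰ := by
  rw [mem_nonZeroDivisors_iff_ne_zero] at hI ⊢
  exact (smul_ne_zero_iff_ne g).2 hI

/-- The conjugate of a nonzero ideal under a ring automorphism, as a nonzero ideal. -/
abbrev conjIdeal (g : G) (I : (Ideal R)⁰) : (Ideal R)⁰ :=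
  ⟨g • I.1, smul_mem_nonZeroDivisors_ideal g I.2⟩

theorem mk0_conjIdeal_eq (g : G) {I J : (Ideal R)⁰} (h : ClassGroup.mk0 I = ClassGroup.mk0 J) :
    ClassGroup.mk0 (conjIdeal g I) = ClassGroup.mk0 (conjIdeal g J) := by
  rw [ClassGroup.mk0_eq_mk0_iff] at h ⊢
  obtain ⟨x, y, hx, hy, h⟩ := h
  refine ⟨g • x, g • y, (smul_ne_zero_iff_ne g).2 hx, (smul_ne_zero_iff_ne g).2 hy, ?_⟩
  have hs : ∀ z : R, Ideal.span {g • z} = g • Ideal.span {z} := fun z ↦ by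
    rw [Ideal.pointwise_smul_def, Ideal.map_span, Set.image_singleton]
    rfl
  rw [hs, hs, ← smul_mul', ← smul_mul', h]

/-- The class of `I` is sent by `g` to the class of `g • I`; the representative is chosen, and
`smul_mk0` shows that the choice does not matter. -/
noncomputable instance classGroupSMul : SMul G (ClassGroup R) where
  smul g c := ClassGroup.mk0 (conjIdeal g (Function.surjInv ClassGroup.mk0_surjective c))

theorem smul_mk0 (g : G) (I : (Ideal R)⁰) :
    g • ClassGroup.mk0 I = ClassGroup.mk0 (conjIdeal g I) :=
  mk0_conjIdeal_eq g (Function.surjInv_eq ClassGroup.mk0_surjective _)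

/-- A group acting on a Dedekind domain by ring automorphisms acts on its class group by
group automorphisms. -/
noncomputable instance classGroupAction : MulDistribMulAction G (ClassGroup R) where
  one_smul c := by
    obtain ⟨I, rfl⟩ := ClassGroup.mk0_surjective c
    rw [smul_mk0]
    exact congrArg _ (Subtype.ext (one_smul G I.1))
  mul_smul g h c := by
    obtain ⟨I, rfl⟩ := ClassGroup.mk0_surjective c
    rw [smul_mk0, smul_mk0, smul_mk0]
    exact congrArg _ (Subtype.ext (mul_smul g h I.1))
  smul_mul g c d := by
    obtain ⟨I, rfl⟩ := ClassGroup.mk0_surjective c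
    obtain ⟨J, rfl⟩ := ClassGroup.mk0_surjective d
    rw [← map_mul, smul_mk0, smul_mk0, smul_mk0, ← map_mul]
    exact congrArg _ (Subtype.ext (smul_mul' g I.1 J.1))
  smul_one g := by
    rw [← map_one ClassGroup.mk0, smul_mk0]
    exact congrArg _ (Subtype.ext (smul_one g))

end Action

/-- The elements killed by `n` form a stable subset for an action by automorphisms. -/
instance powEqOneAction {G A : Type*} [Group G] [CommGroup A] [MulDistribMulAction G A] (n : ℕ) :
    MulAction G {c : A // c ^ n = 1} where
  smul g c := ⟨g • c.1, by rw [← smul_pow', c.2, smul_one]⟩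
  one_smul c := Subtype.ext (one_smul _ _)
  mul_smul g h c := Subtype.ext (mul_smul _ _ _)

section Norm

variable (F L : Type*) [Field L] [NumberField L] [Field F] [NumberField F] [Algebra F L]
  [IsGalois F L]

theorem prod_smul_eq_extendedHom (c : ClassGroup (𝓞 L)) :
    ∃ d, ∏ g : L ≃ₐ[F] L, g • c = ClassGroup.extendedHom (𝓞 F) (𝓞 L) d := by
  obtain ⟨I, rfl⟩ := ClassGroup.mk0_surjective c
  obtain ⟨A, hA⟩ := exists_map_eq_prod_smul F L I.1
  have hprod : (∏ g : L ≃ₐ[F] L, conjIdeal g I : (Ideal (𝓞 L))⁰).1 =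
      A.map (algebraMap (𝓞 F) (𝓞 L)) := by
    rw [hA, Submonoid.coe_finsetProd]
  have hA0 : A ∈ (Ideal (𝓞 F))⁰ := by
    rw [mem_nonZeroDivisors_iff_ne_zero]
    rintro rfl
    refine nonZeroDivisors.ne_zero (∏ g : L ≃ₐ[F] L, conjIdeal g I).2 ?_
    rw [hprod, Ideal.zero_eq_bot, Ideal.map_bot, Ideal.zero_eq_bot]
  refine ⟨ClassGroup.mk0 ⟨A, hA0⟩, ?_⟩
  rw [ClassGroup.extendedHom_mk0]
  simp_rw [smul_mk0]
  rw [← map_prod]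
  exact congrArg _ (Subtype.ext hprod)

/-- For a Galois-invariant class `c`, the norm of `c` is `c ^ [L : F]`, and it comes from the class
group of `F`. -/
theorem pow_mul_classNumber_eq_one {c : ClassGroup (𝓞 L)} (hc : ∀ g : L ≃ₐ[F] L, g • c = c) :
    c ^ (Module.finrank F L * NumberField.classNumber F) = 1 := by
  obtain ⟨d, hd⟩ := prod_smul_eq_extendedHom F L c
  rw [Finset.prod_congr rfl fun g _ ↦ hc g, Finset.prod_const, Finset.card_univ,
    ← Nat.card_eq_fintype_card, IsGalois.card_aut_eq_finrank] at hd
  rw [pow_mul, hd, ← map_pow, NumberField.classNumber, pow_card_eq_one, map_one]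

/-- If `p ∤ h(F)` and `p ≠ [L : F]`, only the trivial class of `p`-torsion is Galois-invariant; all
other orbits have length `q`. -/
theorem card_pow_eq_one_modEq_one {p q : ℕ} (hp : p.Prime) [Fact q.Prime]
    (hdeg : Module.finrank F L = q) (hpq : p ≠ q) (hpF : ¬ p ∣ NumberField.classNumber F) :
    Nat.card {c : ClassGroup (𝓞 L) // c ^ p = 1} ≡ 1 [MOD q] := by
  have hG : IsPGroup q (L ≃ₐ[F] L) := IsPGroup.of_card (n := 1) (by
    rw [IsGalois.card_aut_eq_finrank, hdeg, pow_one])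
  refine (hG.card_modEq_card_fixedPoints {c : ClassGroup (𝓞 L) // c ^ p = 1}).trans ?_
  have hone : (⟨1, one_pow p⟩ : {c : ClassGroup (𝓞 L) // c ^ p = 1}) ∈
      MulAction.fixedPoints (L ≃ₐ[F] L) _ := fun g ↦ Subtype.ext (smul_one g)
  have : Unique (MulAction.fixedPoints (L ≃ₐ[F] L) {c : ClassGroup (𝓞 L) // c ^ p = 1}) :=
    { default := ⟨_, hone⟩
      uniq := by
        rintro ⟨⟨c, hcp⟩, hc⟩
        have h1 := pow_mul_classNumber_eq_one F L (c := c) fun g ↦ congrArg Subtype.val (hc g)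
        have hcop : Nat.Coprime p (Module.finrank F L * NumberField.classNumber F) := by
          rw [hdeg]
          exact Nat.Coprime.mul_right ((Nat.coprime_primes hp Fact.out).2 hpq)
            ((Nat.Prime.coprime_iff_not_dvd hp).2 hpF)
        have h2 : c = 1 := by
          rw [← orderOf_eq_one_iff, ← Nat.dvd_one, ← hcop]
          exact Nat.dvd_gcd (orderOf_dvd_of_pow_eq_one hcp) (orderOf_dvd_of_pow_eq_one h1)
        exact Subtype.ext (Subtype.ext h2) }
  rw [Nat.card_unique]

end Norm

theorem theoremt212141 (L : Type*) [Field L] [NumberField L]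
    (F : Type*) [Field F] [NumberField F] [Algebra F L]
    (hL : 1 < NumberField.classNumber L)
    (hGal : IsGalois F L) (hcyc : IsCyclic (L ≃ₐ[F] L))
    (q : ℕ) (hq : q.Prime) (hodd : Odd q) (hdeg : Module.finrank F L = q)
    (p : ℕ) [Fact p.Prime] (hpH : classNumberBound F < (p : ℝ))
    (hpL : p ∣ NumberField.classNumber L)
    (r : ℕ) (hr : IsPRank p (ClassGroup (𝓞 L)) r) :
    (p : ℤ) * ((p : ℤ) ^ r - 1) ≡ 0 [ZMOD (q : ℤ)] := by
  rw [Int.modEq_zero_iff_dvd]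
  by_cases hpq : p = q
  · exact hpq ▸ dvd_mul_right _ _
  have : Fact q.Prime := ⟨hq⟩
  have hpF : ¬ p ∣ NumberField.classNumber F := fun h ↦ by
    have h1 : (p : ℝ) ≤ NumberField.classNumber F :=
      Nat.cast_le.2 (Nat.le_of_dvd (NumberField.classNumber_pos F) h)
    linarith [classNumber_le_classNumberBound F]
  have h := card_pow_eq_one_modEq_one F L (Fact.out : p.Prime) hdeg hpq hpF
  rw [hr.card_pow_eq_one] at h
  refine Dvd.dvd.mul_left ?_ _
  have := (Nat.modEq_iff_dvd.1 h.symm)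
  exact_mod_cast this
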